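/- Let $w:[0,1]^2\to[0,1]$ be a graphon, i.e. a measurable function with $w(x,y)=w(y,x)$, with degree function $d(x)=\int_0^1 w(x,y)\,dy$ and graphon Laplacian $\mathbb L$ on the real Hilbert space $L^2([0,1])$, $$(\mathbb Lf)(x)=\int_0^1 w(x,y)\,(f(x)-f(y))\,dy .$$ Assume that $w$ is Robinsonian: for all $x,y,z\in[0,1]$, $y<z<x$ implies $w(x,y)\le w(x,z)$, and $x<y<z$ implies $w(x,y)\ge w(x,z)$. Assume moreover: 1. there is $K>0$ with $|w(x,y)-w(x',y')|\le K(|x-x'|+|y-y'|)$ for all $(x,y),(x',y')\in[0,1]^2$; 2. for almost every $(x,y)\in[0,1]^2$ the partial derivative $\frac{\partial w}{\partial x}(x,y)$ exists and is non-zero; 3. $d'(x)$ exists for every $x\in[0,1]$ (one-sidedly at the end points), and $\{x\in[0,1]: d'(x)=0\}$ is countable; 4. $\displaystyle\inf_{f\in\mathcal H}\langle \mathbb Lf,f\rangle<\inf_{x\in[0,1]}d(x)$, where $\mathcal H=\{f\in L^2([0,1]):\int_0^1 f(t)\,dt=0,\ \int_0^1 f(t)^2\,dt=1\}$. Then $\mathbb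 L$ has a smallest non-zero eigenvalue $\lambda_2$ (the Fiedler value), and the eigenspace $\ker(\mathbb L-\lambda_2\mathbb I)\subset L^2([0,1])$ is one-dimensional. -/

import Mathlib

open MeasureTheory Set

/-- Lebesgue measure on the unit interval `[0,1]`. -/
noncomputable abbrev unitMeasure : Measure ℝ := volume.restrict (Icc (0 : ℝ) 1)

/-- The real Hilbert space `L²([0,1])`. -/
abbrev L2Unit : Type := Lp ℝ 2 unitMeasure

/-- A graphon: a measurable symmetric function `w : [0,1]² → [0,1]`. It is carried by a function
on `ℝ × ℝ`, whose values outside `[0,1]²` are unconstrained and never used. -/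
structure Graphon where
  /-- the underlying kernel -/
  toFun : ℝ → ℝ → ℝ
  measurable' : Measurable fun p : Icc (0 : ℝ) 1 × Icc (0 : ℝ) 1 => toFun p.1 p.2
  mem_Icc' : ∀ x ∈ Icc (0 : ℝ) 1, ∀ y ∈ Icc (0 : ℝ) 1, toFun x y ∈ Icc (0 : ℝ) 1
  symm' : ∀ x ∈ Icc (0 : ℝ) 1, ∀ y ∈ Icc (0 : ℝ) 1, toFun x y = toFun y x

namespace Graphon

instance : CoeFun Graphon (fun _ => ℝ → ℝ → ℝ) := ⟨Graphon.toFun⟩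

/-- The degree function `d(x) = ∫₀¹ w(x,y) dy`. -/
noncomputable def degree (w : Graphon) (x : ℝ) : ℝ := ∫ y in Icc (0 : ℝ) 1, w x y

/-- The pointwise formula `∫₀¹ w(x,y) (f(x) - f(y)) dy`. -/
noncomputable def laplacianFun (w : Graphon) (f : ℝ → ℝ) (x : ℝ) : ℝ :=
  ∫ y in Icc (0 : ℝ) 1, w x y * (f x - f y)

theorem aestronglyMeasurable_uncurry (w : Graphon) :
    AEStronglyMeasurable (fun p : ℝ × ℝ => w p.1 p.2) (unitMeasure.prod unitMeasure) := by
  have hS : MeasurableSet (Icc (0 : ℝ) 1 ×ˢ Icc (0 : ℝ) 1) :=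
    measurableSet_Icc.prod measurableSet_Icc
  have hm : Measurable fun p : (Icc (0 : ℝ) 1 ×ˢ Icc (0 : ℝ) 1 : Set (ℝ × ℝ)) =>
      w p.1.1 p.1.2 := by
    have h : Measurable fun p : (Icc (0 : ℝ) 1 ×ˢ Icc (0 : ℝ) 1 : Set (ℝ × ℝ)) =>
        ((⟨p.1.1, p.2.1⟩, ⟨p.1.2, p.2.2⟩) : Icc (0 : ℝ) 1 × Icc (0 : ℝ) 1) :=
      ((measurable_fst.comp measurable_subtype_coe).subtype_mk).prodMk
        ((measurable_snd.comp measurable_subtype_coe).subtype_mk)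
    exact w.measurable'.comp h
  rw [Measure.prod_restrict]
  exact ((aemeasurable_restrict_iff_comap_subtype (f := fun p : ℝ × ℝ => w p.1 p.2) hS).2
    hm.aemeasurable).aestronglyMeasurable

theorem integrable_mul (w : Graphon) {f : ℝ → ℝ} (hf : Integrable f unitMeasure) :
    ∀ᵐ x ∂unitMeasure, Integrable (fun y => w x y * f y) unitMeasure := by
  filter_upwards [w.aestronglyMeasurable_uncurry.prodMk_left, ae_restrict_mem measurableSet_Icc]
    with x hx hxI
  refine hf.bdd_mul (c := 1) hx ?_
  filter_upwards [ae_restrict_mem measurableSet_Icc] with y hy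
  have := w.mem_Icc' x hxI y hy
  rw [Real.norm_eq_abs, abs_of_nonneg this.1]
  exact this.2

theorem integrable_laplacian (w : Graphon) {f : ℝ → ℝ} (hf : Integrable f unitMeasure) :
    ∀ᵐ x ∂unitMeasure, Integrable (fun y => w x y * (f x - f y)) unitMeasure := by
  filter_upwards [w.integrable_mul hf, w.integrable_mul (integrable_const (1 : ℝ))] with x h1 h2
  refine ((h2.mul_const (f x)).sub h1).congr (Filter.Eventually.of_forall fun y => ?_)
  simp only [Pi.sub_apply]
  ring

theorem memLp_laplacianFun (w : Graphon) {f : ℝ → ℝ} (hf : MemLp f 2 unitMeasure) :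
    MemLp (w.laplacianFun f) 2 unitMeasure := by
  have hi : Integrable f unitMeasure := hf.integrable (by norm_num)
  have hmeas : AEStronglyMeasurable (w.laplacianFun f) unitMeasure := by
    refine AEStronglyMeasurable.integral_prod_right' (μ := unitMeasure) (ν := unitMeasure)
      (f := fun p : ℝ × ℝ => w p.1 p.2 * (f p.1 - f p.2)) ?_
    exact w.aestronglyMeasurable_uncurry.mul (hf.1.comp_fst.sub hf.1.comp_snd)
  have hbound : MemLp (fun x => |f x| + ∫ y, |f y| ∂unitMeasure) 2 unitMeasure :=
    hf.abs.add (memLp_const _)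
  refine hbound.mono hmeas ?_
  filter_upwards [ae_restrict_mem measurableSet_Icc] with x hx
  have hc : Integrable (fun y => |f x| + |f y|) unitMeasure :=
    (integrable_const _).add hi.abs
  have h1 : ‖w.laplacianFun f x‖ ≤ ∫ y, (|f x| + |f y|) ∂unitMeasure := by
    refine norm_integral_le_of_norm_le hc ?_
    filter_upwards [ae_restrict_mem measurableSet_Icc] with y hy
    have hw := w.mem_Icc' x hx y hy
    rw [norm_mul, Real.norm_eq_abs, Real.norm_eq_abs, abs_of_nonneg hw.1]
    calc w x y * |f x - f y| ≤ 1 * |f x - f y| :=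
          mul_le_mul_of_nonneg_right hw.2 (abs_nonneg _)
      _ ≤ |f x| + |f y| := by rw [one_mul]; exact abs_sub _ _
  rw [integral_add (integrable_const _) hi.abs] at h1
  refine h1.trans ((le_of_eq ?_).trans (le_abs_self _))
  simp

/-- The graphon Laplacian `(𝕃 f)(x) = ∫₀¹ w(x,y) (f(x) - f(y)) dy` as a linear operator
on `L²([0,1])`. -/
noncomputable def laplacian (w : Graphon) : L2Unit →ₗ[ℝ] L2Unit where
  toFun f := (w.memLp_laplacianFun (Lp.memLp f)).toLp (w.laplacianFun f)
  map_add' f g := by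
    rw [← MemLp.toLp_add, MemLp.toLp_eq_toLp_iff]
    have hf : Integrable f unitMeasure := (Lp.memLp f).integrable (by norm_num)
    have hg : Integrable g unitMeasure := (Lp.memLp g).integrable (by norm_num)
    have hfg := Lp.coeFn_add f g
    filter_upwards [w.integrable_laplacian hf, w.integrable_laplacian hg, hfg] with x h1 h2 h3
    simp only [Pi.add_apply, laplacianFun]
    rw [← integral_add h1 h2]
    refine integral_congr_ae ?_
    filter_upwards [hfg] with y h4
    rw [h3, h4, Pi.add_apply, Pi.add_apply]
    ring
  map_smul' c f := by
    rw [RingHom.id_apply, ← MemLp.toLp_const_smul, MemLp.toLp_eq_toLp_iff]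
    have hcf := Lp.coeFn_smul c f
    filter_upwards [hcf] with x h3
    simp only [Pi.smul_apply, laplacianFun, smul_eq_mul]
    rw [← integral_const_mul]
    refine integral_congr_ae ?_
    filter_upwards [hcf] with y h4
    rw [h3, h4, Pi.smul_apply, Pi.smul_apply, smul_eq_mul, smul_eq_mul]
    ring

/-- Robinsonian (diagonally increasing) graphons. -/
def IsRobinsonian (w : Graphon) : Prop :=
  ∀ x ∈ Icc (0 : ℝ) 1, ∀ y ∈ Icc (0 : ℝ) 1, ∀ z ∈ Icc (0 : ℝ) 1,
    (y < z → z < x → w x y ≤ w x z) ∧ (x < y → y < z → w x z ≤ w x y)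

/-- The graphon is Lipschitz on `[0,1]²`. -/
def IsLipschitz (w : Graphon) : Prop :=
  ∃ K : ℝ, 0 < K ∧ ∀ x ∈ Icc (0 : ℝ) 1, ∀ y ∈ Icc (0 : ℝ) 1,
    ∀ x' ∈ Icc (0 : ℝ) 1, ∀ y' ∈ Icc (0 : ℝ) 1,
      |w x y - w x' y'| ≤ K * (|x - x'| + |y - y'|)

/-- The partial derivative `∂w(x,y)/∂x` exists and is non-zero for almost every
`(x,y) ∈ [0,1]²`. -/
def HasNonzeroPartialDeriv (w : Graphon) : Prop :=
  ∀ᵐ p : ℝ × ℝ ∂(volume.restrict (Icc (0 : ℝ) 1 ×ˢ Icc (0 : ℝ) 1)),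
    ∃ w' : ℝ, HasDerivWithinAt (fun x => w x p.2) w' (Icc (0 : ℝ) 1) p.1 ∧ w' ≠ 0

/-- The degree function is differentiable on `[0,1]` (one-sidedly at the end points) and its
derivative vanishes at most at countably many points. -/
def HasRegularDegree (w : Graphon) : Prop :=
  (∀ x ∈ Icc (0 : ℝ) 1, DifferentiableWithinAt ℝ w.degree (Icc (0 : ℝ) 1) x) ∧
    {x ∈ Icc (0 : ℝ) 1 | derivWithin w.degree (Icc (0 : ℝ) 1) x = 0}.Countable

/-- The set `ℋ` of mean-zero elements of `L²([0,1])` with unit norm. -/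
def meanZeroSphere : Set L2Unit :=
  {f | (∫ t in Icc (0 : ℝ) 1, f t) = 0 ∧ (∫ t in Icc (0 : ℝ) 1, (f t) ^ 2) = 1}

/-- `inf_{f ∈ ℋ} ⟨𝕃 f, f⟩ < inf_{x ∈ [0,1]} d(x)`. -/
def HasSpectralGap (w : Graphon) : Prop :=
  sInf ((fun f : L2Unit => inner ℝ (w.laplacian f) f) '' meanZeroSphere) <
    sInf (w.degree '' Icc (0 : ℝ) 1)

/-- `l` is the Fiedler value of `w`: the smallest non-zero eigenvalue of the graphon Laplacian. -/
def IsFiedlerValue (w : Graphon) (l : ℝ) : Prop :=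
  IsLeast {a : ℝ | a ≠ 0 ∧ Module.End.HasEigenvalue w.laplacian a} l

end Graphon

/-! Let `gap` be the infimum of the quadratic form on the mean-zero unit sphere. Since 𝕃 is
multiplication by d minus a compact operator and `gap < inf d`, the infimum is attained
(`exists_minimizer`). Minimizers are eigenvectors, and `gap` is the Fiedler value.

Let f satisfy 𝕃f = λf with λ = `gap`. Dividing by d - λ > 0 gives a Lipschitz representative. Let F
be the primitive of |f'| shifted to mean zero: F is monotone and |f(x)-f(y)| ≤ |F(x)-F(y)|.
Differentiating the equation gives (d-λ)f' = -∫ ∂ₓw(x,y)(f(x)-f(y)) dy. The Robinson property fixes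
the sign of ∂ₓw on either side of the diagonal, so absolute values yield (d-λ)|f'| ≤ -∫
∂ₓw(x,y)(F(x)-F(y)) dy: the function u = λF - 𝕃F is nondecreasing (`hasDerivAt_defect`). Chebyshev's
inequality then gives ∫ uF ≥ 0, so F is a minimizer up to scaling and u = 0. Equality throughout,
with ∂ₓw ≠ 0, forces |F(x)-F(y)| = |f(x)-f(y)| everywhere.

If moreover f(0) = f(1), then F(0) = F(1), so F and f are constant, and f = 0 by mean zero. Hence f
↦ f(0) - f(1) is injective on the eigenspace, which has dimension at most one. -/

/-! ### Lipschitz kernels and their integral operators -/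

/-- A symmetric kernel with values in `[0,1]` that is Lipschitz on the whole plane. -/
structure LipKernel (k : ℝ → ℝ → ℝ) (K : ℝ) : Prop where
  lip : ∀ x y x' y', |k x y - k x' y'| ≤ K * (|x - x'| + |y - y'|)
  nonneg : ∀ x y, 0 ≤ k x y
  le_one : ∀ x y, k x y ≤ 1
  symm : ∀ x y, k x y = k y x

/-- The integral operator `x ↦ ∫₀¹ k(x,y) f(y) dy`. -/
noncomputable def kernelInt (k : ℝ → ℝ → ℝ) (f : ℝ → ℝ) (x : ℝ) : ℝ :=
  ∫ y, k x y * f y ∂unitMeasure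

/-- The degree `x ↦ ∫₀¹ k(x,y) dy`. -/
noncomputable def kernelDeg (k : ℝ → ℝ → ℝ) (x : ℝ) : ℝ := ∫ y, k x y ∂unitMeasure

/-- The Laplacian `x ↦ d(x) f(x) - ∫₀¹ k(x,y) f(y) dy`. -/
noncomputable def kernelLap (k : ℝ → ℝ → ℝ) (f : ℝ → ℝ) (x : ℝ) : ℝ :=
  kernelDeg k x * f x - kernelInt k f x

theorem integrable_unitMeasure_of_continuous {f : ℝ → ℝ} (hf : Continuous f) :
    Integrable f unitMeasure :=
  hf.continuousOn.integrableOn_Icc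

theorem kernelDeg_eq (k : ℝ → ℝ → ℝ) : kernelDeg k = kernelInt k fun _ => 1 := by
  funext x
  simp [kernelDeg, kernelInt]

namespace LipKernel

variable {k : ℝ → ℝ → ℝ} {K : ℝ} {f : ℝ → ℝ}

theorem K_nonneg (hk : LipKernel k K) : 0 ≤ K := by
  have h := (abs_nonneg _).trans (hk.lip 0 0 1 0)
  simpa using h

theorem continuous_uncurry (hk : LipKernel k K) : Continuous (Function.uncurry k) := by
  have : LipschitzWith (Real.toNNReal (K * 2)) (Function.uncurry k) := by
    refine LipschitzWith.of_dist_le_mul fun p q => ?_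
    rw [Real.coe_toNNReal _ (mul_nonneg hk.K_nonneg zero_le_two), Real.dist_eq, mul_assoc]
    refine (hk.lip p.1 p.2 q.1 q.2).trans (mul_le_mul_of_nonneg_left ?_ hk.K_nonneg)
    have h1 : |p.1 - q.1| ≤ dist p q := le_max_left _ _
    have h2 : |p.2 - q.2| ≤ dist p q := le_max_right _ _
    linarith
  exact this.continuous

theorem continuous_right (hk : LipKernel k K) (x : ℝ) : Continuous (k x) :=
  hk.continuous_uncurry.comp (Continuous.prodMk_right x)

theorem abs_le_one (hk : LipKernel k K) (x y : ℝ) : |k x y| ≤ 1 := by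
  rw [abs_of_nonneg (hk.nonneg x y)]
  exact hk.le_one x y

theorem integrable_mul (hk : LipKernel k K) (hf : Integrable f unitMeasure) (x : ℝ) :
    Integrable (fun y => k x y * f y) unitMeasure :=
  hf.bdd_mul (c := 1) (hk.continuous_right x).aestronglyMeasurable
    (Filter.Eventually.of_forall fun y => hk.abs_le_one x y)

theorem lip_left (hk : LipKernel k K) (x x' y : ℝ) : |k x y - k x' y| ≤ K * |x - x'| := by
  simpa using hk.lip x y x' y

theorem abs_kernelInt_sub_le (hk : LipKernel k K) (hf : Integrable f unitMeasure) (x x' : ℝ) :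
    |kernelInt k f x - kernelInt k f x'| ≤ (K * ∫ y, |f y| ∂unitMeasure) * |x - x'| := by
  rw [kernelInt, kernelInt, ← integral_sub (hk.integrable_mul hf x) (hk.integrable_mul hf x')]
  have h : ∀ y, ‖k x y * f y - k x' y * f y‖ ≤ K * |x - x'| * |f y| := fun y => by
    rw [← sub_mul, norm_mul]
    exact mul_le_mul_of_nonneg_right (hk.lip_left x x' y) (abs_nonneg _)
  refine (norm_integral_le_of_norm_le (hf.abs.const_mul _)
    (Filter.Eventually.of_forall h)).trans (le_of_eq ?_)
  rw [integral_const_mul]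
  ring

theorem abs_kernelInt_le (hk : LipKernel k K) (hf : Integrable f unitMeasure) (x : ℝ) :
    |kernelInt k f x| ≤ ∫ y, |f y| ∂unitMeasure := by
  refine norm_integral_le_of_norm_le (f := fun y => k x y * f y) hf.abs
    (Filter.Eventually.of_forall fun y => ?_)
  rw [norm_mul]
  exact mul_le_of_le_one_left (abs_nonneg _) (hk.abs_le_one x y)

theorem lipschitzWith_kernelInt (hk : LipKernel k K) (hf : Integrable f unitMeasure) :
    LipschitzWith (Real.toNNReal (K * ∫ y, |f y| ∂unitMeasure)) (kernelInt k f) := by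
  refine LipschitzWith.of_dist_le_mul fun x x' => ?_
  rw [Real.coe_toNNReal _ (mul_nonneg hk.K_nonneg (integral_nonneg fun _ => abs_nonneg _))]
  exact hk.abs_kernelInt_sub_le hf x x'

theorem continuous_kernelInt (hk : LipKernel k K) (hf : Integrable f unitMeasure) :
    Continuous (kernelInt k f) :=
  (hk.lipschitzWith_kernelInt hf).continuous

theorem lipschitzWith_kernelDeg (hk : LipKernel k K) :
    LipschitzWith (Real.toNNReal K) (kernelDeg k) := by
  have h := hk.lipschitzWith_kernelInt (f := fun _ => 1) (integrable_const _)
  rw [kernelDeg_eq]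
  simpa using h

theorem continuous_kernelDeg (hk : LipKernel k K) : Continuous (kernelDeg k) :=
  hk.lipschitzWith_kernelDeg.continuous

theorem continuous_kernelLap (hk : LipKernel k K) (hf : Continuous f) :
    Continuous (kernelLap k f) :=
  (hk.continuous_kernelDeg.mul hf).sub
    (hk.continuous_kernelInt (integrable_unitMeasure_of_continuous hf))

/-- Differentiation under the integral sign; the Lipschitz bound on the kernel supplies the
dominating function K|f(y)|. -/
theorem hasDerivAt_kernelInt (hk : LipKernel k K) (hf : Integrable f unitMeasure) {x : ℝ}
    (hd : ∀ᵐ y ∂unitMeasure, DifferentiableAt ℝ (fun t => k t y) x) :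
    Integrable (fun y => deriv (fun t => k t y) x * f y) unitMeasure ∧
      HasDerivAt (kernelInt k f) (∫ y, deriv (fun t => k t y) x * f y ∂unitMeasure) x := by
  refine hasDerivAt_integral_of_dominated_loc_of_lip (s := univ) (bound := fun y => K * |f y|)
    (F := fun t y => k t y * f y) Filter.univ_mem ?_ (hk.integrable_mul hf x) ?_ ?_
    (hf.abs.const_mul K) ?_
  · exact Filter.Eventually.of_forall fun t => (hk.integrable_mul hf t).1
  · have hc : Continuous (Function.uncurry fun y t => k t y) :=
      hk.continuous_uncurry.comp continuous_swap
    have hm : Measurable fun y => deriv (fun t => k t y) x :=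
      (measurable_deriv_with_param hc).comp measurable_prodMk_right
    exact hm.aestronglyMeasurable.mul hf.1
  · refine Filter.Eventually.of_forall fun y => LipschitzWith.lipschitzOnWith ?_
    refine LipschitzWith.of_dist_le_mul fun a b => ?_
    rw [Real.coe_nnabs, abs_of_nonneg (mul_nonneg hk.K_nonneg (abs_nonneg _)), Real.dist_eq,
      Real.dist_eq, ← sub_mul, abs_mul]
    calc |k a y - k b y| * |f y| ≤ K * |a - b| * |f y| :=
          mul_le_mul_of_nonneg_right (hk.lip_left a b y) (abs_nonneg _)
      _ = K * |f y| * |a - b| := by ring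
  · filter_upwards [hd] with y hy
    exact hy.hasDerivAt.mul_const (f y)

/-- The degree is itself an integral of the kernel, so its derivative merges with that of the
integral term, leaving only the increments f(x) - f(y). -/
theorem hasDerivAt_kernelLap (hk : LipKernel k K) (hf : Continuous f) {x f' : ℝ}
    (hd : ∀ᵐ y ∂unitMeasure, DifferentiableAt ℝ (fun t => k t y) x) (hf' : HasDerivAt f f' x) :
    Integrable (fun y => deriv (fun t => k t y) x * (f x - f y)) unitMeasure ∧
      HasDerivAt (kernelLap k f) (kernelDeg k x * f' +
        ∫ y, deriv (fun t => k t y) x * (f x - f y) ∂unitMeasure) x := by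
  obtain ⟨hi, hI⟩ := hk.hasDerivAt_kernelInt (integrable_unitMeasure_of_continuous hf) hd
  obtain ⟨hi1, hI1⟩ := hk.hasDerivAt_kernelInt (f := fun _ => 1) (integrable_const _) hd
  rw [← kernelDeg_eq] at hI1
  simp only [mul_one] at hi1 hI1
  have e : (fun y => deriv (fun t => k t y) x * (f x - f y)) =
      fun y => deriv (fun t => k t y) x * f x - deriv (fun t => k t y) x * f y := by
    funext y
    ring
  rw [e]
  refine ⟨(hi1.mul_const _).sub hi, ?_⟩
  rw [integral_sub (hi1.mul_const _) hi, integral_mul_const]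
  convert! (hI1.mul hf').sub hI using 1
  ring

end LipKernel

/-! ### The monotone primitive of |f'| -/

/-- The indefinite integral of `|f'|`, normalised to vanish at `0`. -/
noncomputable def absDerivPrimitive (f : ℝ → ℝ) (x : ℝ) : ℝ := ∫ t in (0 : ℝ)..x, |deriv f t|

namespace LipschitzWith

variable {f : ℝ → ℝ} {C : NNReal}

theorem absolutelyContinuous (hf : LipschitzWith C f) (a b : ℝ) :
    AbsolutelyContinuousOnInterval f a b :=
  hf.lipschitzOnWith.absolutelyContinuousOnInterval

theorem intervalIntegrable_abs_deriv (hf : LipschitzWith C f) (a b : ℝ) :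
    IntervalIntegrable (fun t => |deriv f t|) volume a b :=
  (hf.absolutelyContinuous a b).intervalIntegrable_deriv.abs

theorem absDerivPrimitive_sub (hf : LipschitzWith C f) (x y : ℝ) :
    absDerivPrimitive f y - absDerivPrimitive f x = ∫ t in x..y, |deriv f t| :=
  intervalIntegral.integral_interval_sub_left (hf.intervalIntegrable_abs_deriv _ _)
    (hf.intervalIntegrable_abs_deriv _ _)

theorem monotone_absDerivPrimitive (hf : LipschitzWith C f) : Monotone (absDerivPrimitive f) :=
  fun x y hxy => by
    rw [← sub_nonneg, hf.absDerivPrimitive_sub]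
    exact intervalIntegral.integral_nonneg hxy fun _ _ => abs_nonneg _

theorem abs_sub_le_absDerivPrimitive (hf : LipschitzWith C f) (x y : ℝ) :
    |f x - f y| ≤ |absDerivPrimitive f x - absDerivPrimitive f y| := by
  wlog h : y ≤ x generalizing x y
  · rw [abs_sub_comm, abs_sub_comm (absDerivPrimitive f x)]
    exact this y x (le_of_not_ge h)
  rw [hf.absDerivPrimitive_sub, ← (hf.absolutelyContinuous y x).integral_deriv_eq_sub]
  exact (intervalIntegral.abs_integral_le_integral_abs h).trans (le_abs_self _)

theorem abs_deriv_le (hf : LipschitzWith C f) (x : ℝ) : |deriv f x| ≤ C :=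
  norm_deriv_le_of_lipschitz hf

theorem ae_hasDerivAt_absDerivPrimitive (hf : LipschitzWith C f) :
    ∀ᵐ x, HasDerivAt (absDerivPrimitive f) |deriv f x| x := by
  have h : LocallyIntegrable (fun t => |deriv f t|) volume := by
    refine (locallyIntegrable_const (C : ℝ)).mono
      (measurable_deriv f).abs.aestronglyMeasurable (Filter.Eventually.of_forall fun x => ?_)
    rw [Real.norm_eq_abs, abs_abs]
    exact (hf.abs_deriv_le x).trans (le_abs_self _)
  filter_upwards [_root_.LocallyIntegrable.ae_hasDerivAt_integral h] with x hx using hx 0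

theorem lipschitzWith_absDerivPrimitive (hf : LipschitzWith C f) :
    LipschitzWith C (absDerivPrimitive f) := by
  refine LipschitzWith.of_dist_le_mul fun x y => ?_
  rw [Real.dist_eq, hf.absDerivPrimitive_sub, Real.dist_eq]
  exact intervalIntegral.norm_integral_le_of_norm_le_const (C := C) fun t _ => by
    rw [Real.norm_eq_abs, abs_abs]
    exact hf.abs_deriv_le t

end LipschitzWith

/-! ### Sign and monotonicity lemmas on the unit interval -/

/-- Here p stands for the partial derivative of the kernel at (x,y): for monotone F its sign is
always opposite to that of F(x) - F(y). -/
theorem mul_sub_eq_neg_abs_of_monotone {F : ℝ → ℝ} (hF : Monotone F) {x y p : ℝ}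
    (h1 : y < x → p < 0) (h2 : x < y → 0 < p) :
    p * (F x - F y) = -(|p| * |F x - F y|) := by
  rcases lt_trichotomy y x with h | rfl | h
  · rw [abs_of_neg (h1 h), abs_of_nonneg (sub_nonneg.2 (hF h.le))]
    ring
  · simp
  · rw [abs_of_pos (h2 h), abs_of_nonpos (sub_nonpos.2 (hF h.le))]
    ring

theorem monotoneOn_Icc_of_deriv_nonneg_ae {u : ℝ → ℝ}
    (hu : AbsolutelyContinuousOnInterval u 0 1)
    (h : ∀ᵐ x ∂unitMeasure, 0 ≤ deriv u x) : MonotoneOn u (Icc 0 1) := by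
  intro a ha b hb hab
  have hs : uIcc a b ⊆ uIcc 0 1 := by
    rw [uIcc_of_le hab, uIcc_of_le zero_le_one]
    exact Icc_subset_Icc ha.1 hb.2
  rw [← sub_nonneg, ← (hu.mono hs).integral_deriv_eq_sub]
  refine intervalIntegral.integral_nonneg_of_ae_restrict hab ?_
  exact ae_restrict_of_ae_restrict_of_subset (Icc_subset_Icc ha.1 hb.2) h

/-- Chebyshev's inequality: F has a zero c because its mean is zero, and u may be replaced by u -
u(c), which has the same sign as F. -/
theorem integral_mul_nonneg_of_monotoneOn {u F : ℝ → ℝ} (hu : MonotoneOn u (Icc 0 1))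
    (huc : Continuous u) (hF : Monotone F) (hFc : Continuous F)
    (h0 : ∫ x, F x ∂unitMeasure = 0) : 0 ≤ ∫ x, u x * F x ∂unitMeasure := by
  have hFi := integrable_unitMeasure_of_continuous hFc
  have hl : F 0 ≤ 0 := by
    have := setIntegral_mono_on (integrable_const (μ := unitMeasure) (F 0)) hFi measurableSet_Icc
      fun x hx => hF hx.1
    simpa [h0] using this
  have hr : 0 ≤ F 1 := by
    have := setIntegral_mono_on hFi (integrable_const (μ := unitMeasure) (F 1)) measurableSet_Icc
      fun x hx => hF hx.2
    simpa [h0] using this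
  obtain ⟨c, hc, hFcz⟩ := intermediate_value_Icc zero_le_one hFc.continuousOn
    (show (0 : ℝ) ∈ Icc (F 0) (F 1) from ⟨hl, hr⟩)
  have e : ∫ x, u x * F x ∂unitMeasure = ∫ x, (u x - u c) * F x ∂unitMeasure := by
    simp_rw [sub_mul]
    rw [integral_sub (integrable_unitMeasure_of_continuous (huc.fun_mul hFc)) (hFi.const_mul _),
      integral_const_mul, h0]
    ring
  rw [e]
  refine setIntegral_nonneg measurableSet_Icc fun x hx => ?_
  rcases le_total x c with h | h
  · exact mul_nonneg_of_nonpos_of_nonpos (sub_nonpos.2 (hu hx hc h)) (hFcz ▸ hF h)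
  · exact mul_nonneg (sub_nonneg.2 (hu hc hx h)) (hFcz ▸ hF h)

theorem eqOn_Icc_of_ae_unitMeasure {f g : ℝ → ℝ} (hf : Continuous f) (hg : Continuous g)
    (h : ∀ᵐ x ∂unitMeasure, f x = g x) : ∀ x ∈ Icc (0 : ℝ) 1, f x = g x := fun _ hx =>
  Measure.eqOn_Icc_of_ae_eq volume zero_ne_one h hf.continuousOn hg.continuousOn hx

theorem ae_unitMeasure_mem_Ioo : ∀ᵐ x ∂unitMeasure, x ∈ Ioo (0 : ℝ) 1 := by
  have h : unitMeasure = volume.restrict (Ioo (0 : ℝ) 1) :=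
    (Measure.restrict_congr_set Ioo_ae_eq_Icc).symm
  rw [h]
  exact ae_restrict_mem measurableSet_Ioo

/-! ### Comparing an eigenfunction with its monotone primitive -/

/-- The first partial derivative exists almost everywhere, is negative below the diagonal and
positive above it. -/
def StrictRobinson (k : ℝ → ℝ → ℝ) : Prop :=
  ∀ᵐ x ∂unitMeasure, ∀ᵐ y ∂unitMeasure, DifferentiableAt ℝ (fun t => k t y) x ∧
    (y < x → deriv (fun t => k t y) x < 0) ∧ (x < y → 0 < deriv (fun t => k t y) x)

namespace LipKernel

variable {k : ℝ → ℝ → ℝ} {K : ℝ} {f F : ℝ → ℝ}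

theorem absolutelyContinuous_kernelLap (hk : LipKernel k K) {C : NNReal}
    (hf : LipschitzWith C f) : AbsolutelyContinuousOnInterval (kernelLap k f) 0 1 :=
  ((hk.lipschitzWith_kernelDeg.absolutelyContinuous 0 1).fun_mul
    (hf.absolutelyContinuous 0 1)).fun_sub ((hk.lipschitzWith_kernelInt
      (integrable_unitMeasure_of_continuous hf.continuous)).absolutelyContinuous 0 1)

/-- Comparing the derivatives of the eigenvalue equation for `f` and for the rearrangement `F`. -/
theorem hasDerivAt_defect (hk : LipKernel k K) {μ x f' : ℝ} (hf : Continuous f)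
    (hF : Continuous F) (hFm : Monotone F) (hfF : ∀ x y, |f x - f y| ≤ |F x - F y|)
    (hD : ∀ᵐ y ∂unitMeasure, DifferentiableAt ℝ (fun t => k t y) x ∧
      (y < x → deriv (fun t => k t y) x < 0) ∧ (x < y → 0 < deriv (fun t => k t y) x))
    (heq : kernelLap k f =ᶠ[nhds x] fun t => μ * f t) (hμ : μ ≤ kernelDeg k x)
    (hf' : HasDerivAt f f' x) (hF' : HasDerivAt F |f'| x) :
    ∃ v, HasDerivAt (fun t => μ * F t - kernelLap k F t) v x ∧ 0 ≤ v ∧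
      (v = 0 → ∀ᵐ y ∂unitMeasure, |F x - F y| = |f x - f y|) := by
  set p : ℝ → ℝ := fun y => deriv (fun t => k t y) x with hp
  obtain ⟨hi, hI⟩ := hk.hasDerivAt_kernelLap hf (hD.mono fun _ h => h.1) hf'
  obtain ⟨hj, hJ⟩ := hk.hasDerivAt_kernelLap hF (hD.mono fun _ h => h.1) hF'
  -- Both sides are the derivative at x of the eigenvalue equation.
  have h1 : kernelDeg k x * f' + ∫ y, p y * (f x - f y) ∂unitMeasure = μ * f' :=
    hI.unique ((hf'.const_mul μ).congr_of_eventuallyEq heq)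
  have hsgn : ∀ᵐ y ∂unitMeasure, p y * (F x - F y) = -(|p y| * |F x - F y|) := by
    filter_upwards [hD] with y hy using mul_sub_eq_neg_abs_of_monotone hFm hy.2.1 hy.2.2
  have hj' : Integrable (fun y => |p y| * |F x - F y|) unitMeasure := by
    simpa [abs_mul] using hj.abs
  have hi' : Integrable (fun y => |p y| * |f x - f y|) unitMeasure := by
    simpa [abs_mul] using hi.abs
  have h2 : |∫ y, p y * (f x - f y) ∂unitMeasure| ≤ ∫ y, |p y| * |f x - f y| ∂unitMeasure := by
    simpa [abs_mul] using abs_integral_le_integral_abs (f := fun y => p y * (f x - f y))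
  have h3 : ∫ y, |p y| * |f x - f y| ∂unitMeasure ≤ ∫ y, |p y| * |F x - F y| ∂unitMeasure :=
    integral_mono hi' hj' fun y => mul_le_mul_of_nonneg_left (hfF x y) (abs_nonneg _)
  have h4 : |∫ y, p y * (f x - f y) ∂unitMeasure| = (kernelDeg k x - μ) * |f'| := by
    rw [show ∫ y, p y * (f x - f y) ∂unitMeasure = -((kernelDeg k x - μ) * f') by linarith,
      abs_neg, abs_mul, abs_of_nonneg (sub_nonneg.2 hμ)]
  have h5 : ∫ y, p y * (F x - F y) ∂unitMeasure = -∫ y, |p y| * |F x - F y| ∂unitMeasure := by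
    rw [← integral_neg]
    exact integral_congr_ae hsgn
  -- By `h5` the derivative is ∫|p||F(x)-F(y)| - (d(x)-μ)|f'|, nonnegative by `h2`, `h3` and `h4`.
  refine ⟨_, (hF'.const_mul μ).sub hJ, ?_, fun hv => ?_⟩
  · rw [h5]
    linarith
  · rw [h5] at hv
    -- Vanishing of the derivative forces equality in `h3`; since p ≠ 0 off the diagonal, the
    -- increments agree in absolute value.
    have h6 : ∫ y, (|p y| * |F x - F y| - |p y| * |f x - f y|) ∂unitMeasure = 0 := by
      rw [integral_sub hj' hi']
      linarith
    have h7 := (integral_eq_zero_iff_of_nonneg (fun y => sub_nonneg.2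
      (mul_le_mul_of_nonneg_left (hfF x y) (abs_nonneg (p y)))) (hj'.sub hi')).1 h6
    filter_upwards [h7, hD] with y hy hDy
    rcases eq_or_ne y x with rfl | hne
    · simp
    · have hp0 : |p y| ≠ 0 := abs_ne_zero.2 <| by
        rcases lt_or_gt_of_ne hne with h | h
        exacts [(hDy.2.1 h).ne, (hDy.2.2 h).ne']
      exact mul_left_cancel₀ hp0 (sub_eq_zero.1 hy)

/-- `hvar` is the variational principle: a mean-zero F whose quadratic form does not exceed μ‖F‖² is
an eigenfunction. It is applied to the centred primitive of |f'|. -/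
theorem eq_of_kernelLap_eq_of_eq_endpoints (hk : LipKernel k K) (hD : StrictRobinson k)
    {μ : ℝ} {C : NNReal} (hf : LipschitzWith C f)
    (heq : ∀ x ∈ Icc (0 : ℝ) 1, kernelLap k f x = μ * f x)
    (hμ : ∀ x ∈ Icc (0 : ℝ) 1, μ ≤ kernelDeg k x)
    (hvar : ∀ F : ℝ → ℝ, Continuous F → ∫ x, F x ∂unitMeasure = 0 →
      0 ≤ ∫ x, (μ * F x - kernelLap k F x) * F x ∂unitMeasure →
      ∀ x ∈ Icc (0 : ℝ) 1, kernelLap k F x = μ * F x)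
    (h01 : f 0 = f 1) : ∀ x ∈ Icc (0 : ℝ) 1, f x = f 0 := by
  set c := ∫ x, absDerivPrimitive f x ∂unitMeasure with hc
  set F : ℝ → ℝ := fun x => absDerivPrimitive f x - c with hF
  have hPc := hf.lipschitzWith_absDerivPrimitive.continuous
  have hFL : LipschitzWith C F := by
    refine LipschitzWith.of_dist_le_mul fun x y => ?_
    rw [hF, dist_sub_right]
    exact hf.lipschitzWith_absDerivPrimitive.dist_le_mul x y
  have hFm : Monotone F := fun x y h => sub_le_sub_right (hf.monotone_absDerivPrimitive h) c
  have hfF : ∀ x y, |f x - f y| ≤ |F x - F y| := fun x y => by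
    rw [hF, sub_sub_sub_cancel_right]
    exact hf.abs_sub_le_absDerivPrimitive x y
  have hF0 : ∫ x, F x ∂unitMeasure = 0 := by
    rw [hF, integral_sub (integrable_unitMeasure_of_continuous hPc) (integrable_const _)]
    simp [hc]
  have hder : ∀ᵐ x ∂unitMeasure, x ∈ Ioo (0 : ℝ) 1 ∧
      ∃ v, HasDerivAt (fun t => μ * F t - kernelLap k F t) v x ∧ 0 ≤ v ∧
      (v = 0 → ∀ᵐ y ∂unitMeasure, |F x - F y| = |f x - f y|) := by
    filter_upwards [ae_unitMeasure_mem_Ioo, hD, ae_restrict_of_ae hf.ae_differentiableAt_real,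
      ae_restrict_of_ae hf.ae_hasDerivAt_absDerivPrimitive] with x hx hDx hfx hPx
    refine ⟨hx, hk.hasDerivAt_defect hf.continuous hFL.continuous hFm hfF hDx ?_
      (hμ x (Ioo_subset_Icc_self hx)) hfx.hasDerivAt (hPx.sub_const c)⟩
    filter_upwards [Icc_mem_nhds hx.1 hx.2] with t ht using heq t ht
  have hucont : Continuous fun t => μ * F t - kernelLap k F t :=
    (continuous_const.mul hFL.continuous).sub (hk.continuous_kernelLap hFL.continuous)
  have hum : MonotoneOn (fun t => μ * F t - kernelLap k F t) (Icc 0 1) := by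
    refine monotoneOn_Icc_of_deriv_nonneg_ae (((hFL.absolutelyContinuous 0 1).const_mul μ).fun_sub
      (hk.absolutelyContinuous_kernelLap hFL)) ?_
    filter_upwards [hder] with x ⟨_, v, hv, hv0, _⟩
    rwa [hv.deriv]
  have hu0 := hvar F hFL.continuous hF0
    (integral_mul_nonneg_of_monotoneOn hum hucont hFm hFL.continuous hF0)
  have hae : ∀ᵐ x ∂unitMeasure, ∀ y ∈ Icc (0 : ℝ) 1, |F x - F y| = |f x - f y| := by
    filter_upwards [hder] with x ⟨hx, v, hv, _, hv0⟩
    refine eqOn_Icc_of_ae_unitMeasure (continuous_const.sub hFL.continuous).abs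
      (continuous_const.sub hf.continuous).abs (hv0 ?_)
    -- The defect vanishes identically on the interval, hence so does its derivative at the interior
    -- point x.
    refine hv.unique ((hasDerivAt_const x (0 : ℝ)).congr_of_eventuallyEq ?_)
    filter_upwards [Icc_mem_nhds hx.1 hx.2] with t ht
    rw [hu0 t ht, sub_self]
  have hall : ∀ x ∈ Icc (0 : ℝ) 1, ∀ y ∈ Icc (0 : ℝ) 1, |F x - F y| = |f x - f y| := by
    intro x hx y hy
    exact eqOn_Icc_of_ae_unitMeasure (f := fun x => |F x - F y|) (g := fun x => |f x - f y|)
      (hFL.continuous.sub continuous_const).abs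
      (hf.continuous.sub continuous_const).abs (hae.mono fun x h => h y hy) x hx
  intro x hx
  have h0 : F 0 = F 1 := by
    have := hall 0 (left_mem_Icc.2 zero_le_one) 1 (right_mem_Icc.2 zero_le_one)
    rw [h01, sub_self, abs_zero, abs_eq_zero, sub_eq_zero] at this
    exact this
  have h1 : F x = F 0 := le_antisymm ((hFm hx.2).trans h0.ge) (hFm hx.1)
  have h2 := hfF x 0
  rw [h1, sub_self, abs_zero] at h2
  exact sub_eq_zero.1 (abs_nonpos_iff.1 h2)

end LipKernel

/-! ### Positivity of the kernel and the null space of the Laplacian -/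

instance : IsProbabilityMeasure unitMeasure := ⟨by simp⟩

namespace LipKernel

variable {k : ℝ → ℝ → ℝ} {K : ℝ} {f : ℝ → ℝ}

/-- As k ≥ 0, a zero of k is a minimum in the first variable, where the partial derivative would
vanish. -/
theorem ae_pos (hk : LipKernel k K) (hD : StrictRobinson k) :
    ∀ᵐ x ∂unitMeasure, ∀ᵐ y ∂unitMeasure, 0 < k x y := by
  filter_upwards [hD] with x hx
  have hne : ∀ᵐ y ∂unitMeasure, y ≠ x := Measure.ae_ne _ x
  filter_upwards [hx, hne] with y hy hyx
  refine (hk.nonneg x y).lt_of_ne fun h0 => ?_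
  have hmin : IsLocalMin (fun t => k t y) x :=
    Filter.Eventually.of_forall fun t => h0.symm.le.trans (hk.nonneg t y)
  rcases lt_or_gt_of_ne hyx with h | h
  · exact (hy.2.1 h).ne hmin.deriv_eq_zero
  · exact (hy.2.2 h).ne' hmin.deriv_eq_zero

theorem kernelLap_eq_integral (hk : LipKernel k K) (hf : Integrable f unitMeasure) (x : ℝ) :
    kernelLap k f x = ∫ y, k x y * (f x - f y) ∂unitMeasure := by
  simp_rw [mul_sub]
  rw [integral_sub ((integrable_unitMeasure_of_continuous (hk.continuous_right x)).mul_const _)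
    (hk.integrable_mul hf x), integral_mul_const]
  rfl

theorem integrable_prod_mul (hk : LipKernel k K) {g : ℝ → ℝ} (hf : Integrable f unitMeasure)
    (hg : Integrable g unitMeasure) :
    Integrable (fun p : ℝ × ℝ => k p.1 p.2 * (g p.1 * f p.2)) (unitMeasure.prod unitMeasure) :=
  (hg.mul_prod hf).bdd_mul (c := 1) hk.continuous_uncurry.aestronglyMeasurable
    (Filter.Eventually.of_forall fun p => hk.abs_le_one p.1 p.2)

theorem integral_kernelInt_mul (hk : LipKernel k K) {g : ℝ → ℝ} (hf : Integrable f unitMeasure)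
    (hg : Integrable g unitMeasure) :
    ∫ x, kernelInt k f x * g x ∂unitMeasure = ∫ x, f x * kernelInt k g x ∂unitMeasure := by
  have h := integral_integral_swap (f := fun x y => k x y * (g x * f y))
    (hk.integrable_prod_mul hf hg)
  have h1 : ∀ x, ∫ y, k x y * (g x * f y) ∂unitMeasure = kernelInt k f x * g x := fun x => by
    rw [kernelInt, ← integral_mul_const]
    congr 1
    funext y
    ring
  have h2 : ∀ y, ∫ x, k x y * (g x * f y) ∂unitMeasure = f y * kernelInt k g y := fun y => by
    rw [kernelInt, ← integral_const_mul]
    congr 1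
    funext x
    rw [hk.symm x y]
    ring
  simpa only [h1, h2] using h

/-- A continuous function in the kernel of the Laplacian is constant. -/
theorem ae_const_of_kernelLap_eq_zero (hk : LipKernel k K) (hD : StrictRobinson k)
    (hf : Continuous f) (h0 : ∀ x ∈ Icc (0 : ℝ) 1, kernelLap k f x = 0) :
    ∃ c, ∀ᵐ y ∂unitMeasure, f y = c := by
  have hfi := integrable_unitMeasure_of_continuous hf
  have hf2 : Continuous fun y => f y ^ 2 := hf.pow 2
  have hlap0 : ∀ {g : ℝ → ℝ}, ∫ x, kernelLap k f x * g x ∂unitMeasure = 0 := fun {g} => by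
    refine (setIntegral_congr_fun measurableSet_Icc (g := fun _ => (0 : ℝ)) fun x hx => ?_).trans
      (by simp)
    simp only [h0 x hx, zero_mul]
  have hcd := hk.continuous_kernelDeg
  have hsq : ∀ x, ∫ y, k x y * (f x - f y) ^ 2 ∂unitMeasure =
      2 * (kernelLap k f x * f x) - kernelDeg k x * f x * f x + kernelInt k (fun y => f y ^ 2) x :=
    fun x => by
    have e : (fun y => k x y * (f x - f y) ^ 2) = fun y =>
        k x y * f x ^ 2 - 2 * f x * (k x y * f y) + k x y * f y ^ 2 := by
      funext y
      ring
    have i1 : Integrable (fun y => k x y * f x ^ 2) unitMeasure :=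
      (integrable_unitMeasure_of_continuous (hk.continuous_right x)).mul_const _
    have i2 := (hk.integrable_mul hfi x).const_mul (2 * f x)
    have i3 := hk.integrable_mul (integrable_unitMeasure_of_continuous hf2) x
    have i12 : Integrable (fun y => k x y * f x ^ 2 - 2 * f x * (k x y * f y)) unitMeasure :=
      i1.sub i2
    rw [e, integral_add i12 i3, integral_sub i1 i2, integral_mul_const, integral_const_mul,
      kernelLap, ← kernelDeg, ← kernelInt, ← kernelInt]
    ring
  have hci := hk.continuous_kernelInt (integrable_unitMeasure_of_continuous hf2)
  have hcl := hk.continuous_kernelLap hf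
  -- The Dirichlet energy equals 2⟨𝕃f, f⟩ = 0: the terms d·f² and ∫ k(x,y)f(y)² dy have the same
  -- integral by symmetry.
  have hzero : ∫ x, ∫ y, k x y * (f x - f y) ^ 2 ∂unitMeasure ∂unitMeasure = 0 := by
    simp_rw [hsq]
    have c1 : Continuous fun x => 2 * (kernelLap k f x * f x) := by fun_prop
    have c2 : Continuous fun x => kernelDeg k x * f x * f x := by fun_prop
    rw [integral_add (integrable_unitMeasure_of_continuous (c1.fun_sub c2))
      (integrable_unitMeasure_of_continuous hci),
      integral_sub (integrable_unitMeasure_of_continuous c1)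
      (integrable_unitMeasure_of_continuous c2), integral_const_mul, hlap0]
    have h := hk.integral_kernelInt_mul (integrable_unitMeasure_of_continuous hf2)
      (integrable_const (1 : ℝ))
    simp only [mul_one, ← kernelDeg_eq] at h
    have h' : ∀ x, kernelDeg k x * f x * f x = f x ^ 2 * kernelDeg k x := fun x => by ring
    simp_rw [h', h]
    simp
  have hnn : ∀ x y, 0 ≤ k x y * (f x - f y) ^ 2 := fun x y =>
    mul_nonneg (hk.nonneg x y) (sq_nonneg _)
  have hcont : Continuous fun x => ∫ y, k x y * (f x - f y) ^ 2 ∂unitMeasure := by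
    simp_rw [hsq]
    fun_prop
  have hz := (integral_eq_zero_iff_of_nonneg (fun x => integral_nonneg (hnn x))
    (integrable_unitMeasure_of_continuous hcont)).1 hzero
  have : ∀ᵐ x ∂unitMeasure, ∀ᵐ y ∂unitMeasure, f y = f x := by
    filter_upwards [hz, hk.ae_pos hD] with x hx hpos
    have hx' := (integral_eq_zero_iff_of_nonneg (hnn x) (integrable_unitMeasure_of_continuous
      ((hk.continuous_right x).mul ((continuous_const.sub hf).pow 2)))).1 hx
    filter_upwards [hx', hpos] with y hy hy0
    rcases mul_eq_zero.1 hy with h | h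
    · exact absurd h hy0.ne'
    · exact (sub_eq_zero.1 (pow_eq_zero_iff two_ne_zero |>.1 h)).symm
  obtain ⟨x, hx⟩ := this.exists
  exact ⟨f x, hx⟩

end LipKernel

/-! ### Extension of the graphon to the plane -/

namespace Graphon

/-- The graphon with both arguments projected to `[0,1]`. -/
noncomputable def clamp (w : Graphon) (x y : ℝ) : ℝ :=
  w (projIcc (0 : ℝ) 1 zero_le_one x) (projIcc (0 : ℝ) 1 zero_le_one y)

variable {w : Graphon}

theorem clamp_eq {x y : ℝ} (hx : x ∈ Icc (0 : ℝ) 1) (hy : y ∈ Icc (0 : ℝ) 1) :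
    w.clamp x y = w x y := by
  rw [clamp, projIcc_of_mem _ hx, projIcc_of_mem _ hy]

/-- The projection onto [0,1] is 1-Lipschitz, so the constant K survives and all later functions are
continuous on the whole line. -/
theorem IsLipschitz.exists_lipKernel (h : w.IsLipschitz) : ∃ K, LipKernel w.clamp K := by
  obtain ⟨K, hK, hL⟩ := h
  have hp : ∀ a b : ℝ, |(projIcc (0 : ℝ) 1 zero_le_one a : ℝ) - projIcc (0 : ℝ) 1 zero_le_one b|
      ≤ |a - b| := fun a b => by
    simpa [Subtype.dist_eq, Real.dist_eq] using
      (LipschitzWith.projIcc (zero_le_one (α := ℝ))).dist_le_mul a b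
  refine ⟨K, fun x y x' y' => ?_, fun x y => ?_, fun x y => ?_, fun x y => ?_⟩
  · refine (hL _ (projIcc _ _ _ x).2 _ (projIcc _ _ _ y).2 _ (projIcc _ _ _ x').2 _
      (projIcc _ _ _ y').2).trans (mul_le_mul_of_nonneg_left ?_ hK.le)
    exact add_le_add (hp _ _) (hp _ _)
  · exact (w.mem_Icc' _ (projIcc _ _ _ x).2 _ (projIcc _ _ _ y).2).1
  · exact (w.mem_Icc' _ (projIcc _ _ _ x).2 _ (projIcc _ _ _ y).2).2
  · exact w.symm' _ (projIcc _ _ _ x).2 _ (projIcc _ _ _ y).2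

/-- Robinson monotonicity in the first variable, read off through symmetry, gives the weak sign of
the derivative; its non-vanishing makes the sign strict. -/
theorem strictRobinson_clamp (hR : w.IsRobinsonian) (h2 : w.HasNonzeroPartialDeriv) :
    StrictRobinson w.clamp := by
  have h2' : ∀ᵐ p : ℝ × ℝ ∂(unitMeasure.prod unitMeasure), ∃ w' : ℝ,
      HasDerivWithinAt (fun x => w x p.2) w' (Icc (0 : ℝ) 1) p.1 ∧ w' ≠ 0 := by
    rw [Measure.prod_restrict]
    exact h2
  filter_upwards [Measure.ae_ae_of_ae_prod h2', ae_unitMeasure_mem_Ioo] with x hx hxI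
  filter_upwards [hx, ae_restrict_mem measurableSet_Icc] with y ⟨w', hw, hw0⟩ hy
  have hnhds := Icc_mem_nhds hxI.1 hxI.2
  have hd : HasDerivAt (fun t => w.clamp t y) w' x := by
    refine (hw.hasDerivAt hnhds).congr_of_eventuallyEq ?_
    filter_upwards [hnhds] with t ht using clamp_eq ht hy
  refine ⟨hd.differentiableAt, fun hyx => ?_, fun hxy => ?_⟩
  · rw [hd.deriv]
    refine lt_of_le_of_ne ?_ hw0
    have hs : Ioo y 1 ∈ nhds x := Ioo_mem_nhds hyx hxI.2
    have ha : AntitoneOn (fun t => w.clamp t y) (Ioo y 1) := by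
      intro s hs t ht hst
      rcases hst.eq_or_lt with rfl | hlt
      · exact le_rfl
      have hsI : s ∈ Icc (0 : ℝ) 1 := ⟨hy.1.trans hs.1.le, hs.2.le⟩
      have htI : t ∈ Icc (0 : ℝ) 1 := ⟨hy.1.trans ht.1.le, ht.2.le⟩
      simp only [clamp_eq hsI hy, clamp_eq htI hy]
      rw [w.symm' s hsI y hy, w.symm' t htI y hy]
      exact (hR y hy s hsI t htI).2 hs.1 hlt
    rw [← hd.deriv, ← derivWithin_of_mem_nhds hs]
    exact ha.derivWithin_nonpos
  · rw [hd.deriv]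
    refine lt_of_le_of_ne ?_ hw0.symm
    have hs : Ioo 0 y ∈ nhds x := Ioo_mem_nhds hxI.1 hxy
    have ha : MonotoneOn (fun t => w.clamp t y) (Ioo 0 y) := by
      intro s hs t ht hst
      rcases hst.eq_or_lt with rfl | hlt
      · exact le_rfl
      have hsI : s ∈ Icc (0 : ℝ) 1 := ⟨hs.1.le, hs.2.le.trans hy.2⟩
      have htI : t ∈ Icc (0 : ℝ) 1 := ⟨ht.1.le, ht.2.le.trans hy.2⟩
      simp only [clamp_eq hsI hy, clamp_eq htI hy]
      rw [w.symm' s hsI y hy, w.symm' t htI y hy]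
      exact (hR y hy s hsI t htI).1 hlt ht.2
    rw [← hd.deriv, ← derivWithin_of_mem_nhds hs]
    exact ha.derivWithin_nonneg

theorem kernelDeg_clamp {x : ℝ} (hx : x ∈ Icc (0 : ℝ) 1) : kernelDeg w.clamp x = w.degree x :=
  setIntegral_congr_fun measurableSet_Icc fun _ hy => clamp_eq hx hy

theorem kernelDeg_clamp_projIcc (x : ℝ) :
    kernelDeg w.clamp x = w.degree (projIcc (0 : ℝ) 1 zero_le_one x) := by
  rw [← kernelDeg_clamp (projIcc _ _ _ x).2]
  simp [kernelDeg, clamp]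

theorem sInf_degree_le (x : ℝ) : sInf (w.degree '' Icc (0 : ℝ) 1) ≤ kernelDeg w.clamp x := by
  rw [kernelDeg_clamp_projIcc]
  refine csInf_le ⟨0, ?_⟩ (mem_image_of_mem _ (projIcc _ _ _ x).2)
  rintro _ ⟨t, ht, rfl⟩
  exact setIntegral_nonneg measurableSet_Icc fun y hy => (w.mem_Icc' t ht y hy).1

theorem integrable_coe (f : L2Unit) : Integrable f unitMeasure :=
  (Lp.memLp f).integrable (by norm_num)

theorem coeFn_laplacian {K : ℝ} (hk : LipKernel w.clamp K) (f : L2Unit) :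
    w.laplacian f =ᵐ[unitMeasure] kernelLap w.clamp f := by
  refine (MemLp.coeFn_toLp (w.memLp_laplacianFun (Lp.memLp f))).trans ?_
  filter_upwards [ae_restrict_mem measurableSet_Icc] with x hx
  rw [hk.kernelLap_eq_integral (integrable_coe f)]
  exact setIntegral_congr_fun measurableSet_Icc fun y hy => by simp only [clamp_eq hx hy]

end Graphon

/-! ### Hilbert space tools and the mean-zero subspace -/

/-- Cauchy–Schwarz for a symmetric operator that is nonnegative on an invariant subspace. -/
theorem norm_sq_apply_le_of_nonneg_on {E : Type*} [NormedAddCommGroup E] [InnerProductSpace ℝ E]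
    {B : E →L[ℝ] E} (hB : (B : E →ₗ[ℝ] E).IsSymmetric) {V : Submodule ℝ E}
    (hV : ∀ f ∈ V, B f ∈ V) (hpos : ∀ f ∈ V, 0 ≤ inner ℝ (B f) f) {f : E} (hf : f ∈ V) :
    ‖B f‖ ^ 2 ≤ (‖B‖ + 1) * inner ℝ (B f) f := by
  set M := ‖B‖ + 1
  have hM : 0 < M := by positivity
  -- One gradient step as test vector: expanding gives ⟨Bf,f⟩ - 2M⁻¹‖Bf‖² + M⁻²⟨BBf,Bf⟩, whose last
  -- term is at most M⁻¹‖Bf‖². The +1 in M keeps it invertible when B = 0.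
  have h := hpos (f - M⁻¹ • B f) (V.sub_mem hf (V.smul_mem _ (hV f hf)))
  have hs : inner ℝ (B (B f)) f = ‖B f‖ ^ 2 := by
    rw [← real_inner_self_eq_norm_sq]
    exact hB (B f) f
  have hb : inner ℝ (B (B f)) (B f) ≤ M * ‖B f‖ ^ 2 := by
    refine (real_inner_le_norm _ _).trans ?_
    have := B.le_opNorm (B f)
    nlinarith [norm_nonneg (B f)]
  simp only [map_sub, map_smul, inner_sub_left, inner_sub_right, real_inner_smul_left,
    real_inner_smul_right, hs, real_inner_self_eq_norm_sq] at h
  have hb' : M⁻¹ * (M⁻¹ * inner ℝ (B (B f)) (B f)) ≤ M⁻¹ * ‖B f‖ ^ 2 := by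
    refine mul_le_mul_of_nonneg_left ?_ (inv_nonneg.2 hM.le)
    rw [inv_mul_le_iff₀ hM]
    exact hb
  have h1 : M⁻¹ * ‖B f‖ ^ 2 ≤ inner ℝ (B f) f := by linarith
  rwa [inv_mul_le_iff₀ hM] at h1

theorem inner_eq_integral (f g : L2Unit) : inner ℝ f g = ∫ x, f x * g x ∂unitMeasure := by
  rw [L2.inner_def]
  exact integral_congr_ae (Filter.Eventually.of_forall fun x => by simp [mul_comm])

theorem norm_sq_eq_integral (f : L2Unit) : ‖f‖ ^ 2 = ∫ x, f x ^ 2 ∂unitMeasure := by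
  rw [← real_inner_self_eq_norm_sq, inner_eq_integral]
  simp_rw [sq]

/-- The constant function `1` in `L²([0,1])`. -/
noncomputable def oneL2 : L2Unit := Lp.const 2 unitMeasure (1 : ℝ)

theorem coeFn_oneL2 : oneL2 =ᵐ[unitMeasure] fun _ => 1 := Lp.coeFn_const ..

/-- The mean-zero subspace of `L²([0,1])`. -/
noncomputable def meanZero : Submodule ℝ L2Unit := (ℝ ∙ oneL2)ᗮ

theorem inner_oneL2 (f : L2Unit) : inner ℝ oneL2 f = ∫ x, f x ∂unitMeasure := by
  rw [inner_eq_integral]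
  refine integral_congr_ae ?_
  filter_upwards [coeFn_oneL2] with x hx
  rw [hx, one_mul]

theorem mem_meanZero {f : L2Unit} : f ∈ meanZero ↔ ∫ x, f x ∂unitMeasure = 0 := by
  rw [meanZero, Submodule.mem_orthogonal_singleton_iff_inner_right, inner_oneL2]

theorem mem_meanZeroSphere {f : L2Unit} :
    f ∈ Graphon.meanZeroSphere ↔ f ∈ meanZero ∧ ‖f‖ = 1 := by
  rw [mem_meanZero, ← sq_eq_sq₀ (norm_nonneg f) zero_le_one, norm_sq_eq_integral, one_pow]
  rfl

theorem meanZeroSphere_nonempty : Graphon.meanZeroSphere.Nonempty := by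
  have hc : Continuous fun x : ℝ => x - 1 / 2 := by fun_prop
  have hm : MemLp (fun x : ℝ => x - 1 / 2) 2 unitMeasure :=
    (memLp_two_iff_integrable_sq hc.aestronglyMeasurable).2
      (integrable_unitMeasure_of_continuous (hc.pow 2))
  have h0 : hm.toLp _ ∈ meanZero := by
    rw [mem_meanZero, integral_congr_ae hm.coeFn_toLp, integral_Icc_eq_integral_Ioc,
      ← intervalIntegral.integral_of_le zero_le_one]
    rw [intervalIntegral.integral_sub (by simp) (by simp)]
    norm_num
  have hne : hm.toLp _ ≠ 0 := fun h => by
    have h' := hm.coeFn_toLp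
    rw [h] at h'
    have h2 : ∀ᵐ x ∂unitMeasure, x - 1 / 2 = (0 : ℝ) := by
      filter_upwards [h', Lp.coeFn_zero ℝ 2 unitMeasure] with x h1 h2
      rw [← h1, h2]
      rfl
    have := eqOn_Icc_of_ae_unitMeasure hc continuous_const h2 0 (left_mem_Icc.2 zero_le_one)
    norm_num at this
  exact ⟨_, mem_meanZeroSphere.2 ⟨meanZero.smul_mem _ h0, norm_smul_inv_norm hne⟩⟩

/-! ### The variational problem and existence of a minimizer -/

namespace Graphon

variable {w : Graphon} {K : ℝ}

theorem kernelInt_congr {k : ℝ → ℝ → ℝ} {f g : ℝ → ℝ} (h : f =ᵐ[unitMeasure] g) :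
    kernelInt k f = kernelInt k g := by
  funext x
  exact integral_congr_ae (h.mono fun y hy => by simp only [hy])

theorem laplacian_isSymmetric (hk : LipKernel w.clamp K) : w.laplacian.IsSymmetric := by
  intro f g
  have hdm : ∀ u v : L2Unit,
      Integrable (fun x => kernelDeg w.clamp x * u x * v x) unitMeasure := fun u v => by
    have h := (Lp.memLp u).integrable_mul (Lp.memLp v)
    refine (h.bdd_mul (c := 1) hk.continuous_kernelDeg.aestronglyMeasurable
      (Filter.Eventually.of_forall fun x => ?_)).congr
      (Filter.Eventually.of_forall fun x => (mul_assoc _ _ _).symm)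
    rw [kernelDeg_eq]
    simpa using hk.abs_kernelInt_le (f := fun _ => 1) (integrable_const _) x
  have hbm : ∀ u v : L2Unit, Integrable (fun x => kernelInt w.clamp u x * v x) unitMeasure :=
    fun u v => (integrable_coe v).bdd_mul
      (hk.continuous_kernelInt (integrable_coe u)).aestronglyMeasurable
      (Filter.Eventually.of_forall fun x => hk.abs_kernelInt_le (integrable_coe u) x)
  have key : ∀ u v : L2Unit, inner ℝ (w.laplacian u) v =
      (∫ x, kernelDeg w.clamp x * u x * v x ∂unitMeasure) -
        ∫ x, kernelInt w.clamp u x * v x ∂unitMeasure := fun u v => by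
    rw [inner_eq_integral, ← integral_sub (hdm u v) (hbm u v)]
    refine integral_congr_ae ?_
    filter_upwards [coeFn_laplacian hk u] with x hx
    rw [hx, kernelLap, sub_mul]
  rw [key, real_inner_comm, key, hk.integral_kernelInt_mul (integrable_coe f) (integrable_coe g)]
  congr 1
  · congr 1
    funext x
    ring
  · congr 1
    funext x
    ring

theorem laplacian_oneL2 (hk : LipKernel w.clamp K) : w.laplacian oneL2 = 0 := by
  refine Lp.ext ?_
  filter_upwards [coeFn_laplacian hk oneL2, coeFn_oneL2, Lp.coeFn_zero ℝ 2 unitMeasure]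
    with x h1 h2 h3
  rw [h1, h3, kernelLap, kernelInt_congr coeFn_oneL2, ← kernelDeg_eq, h2]
  simp

/-- The operator `𝕃 - μ` as a bounded operator. -/
noncomputable def shiftedLaplacian (hk : LipKernel w.clamp K) (μ : ℝ) : L2Unit →L[ℝ] L2Unit :=
  -- Boundedness is Hellinger–Toeplitz: an everywhere defined symmetric operator is continuous.
  ⟨w.laplacian, (laplacian_isSymmetric hk).continuous⟩ - μ • ContinuousLinearMap.id ℝ L2Unit

theorem shiftedLaplacian_apply (hk : LipKernel w.clamp K) (μ : ℝ) (f : L2Unit) :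
    shiftedLaplacian hk μ f = w.laplacian f - μ • f := rfl

theorem shiftedLaplacian_isSymmetric (hk : LipKernel w.clamp K) (μ : ℝ) :
    (shiftedLaplacian hk μ : L2Unit →ₗ[ℝ] L2Unit).IsSymmetric := by
  intro f g
  change inner ℝ (w.laplacian f - μ • f) g = inner ℝ f (w.laplacian g - μ • g)
  rw [inner_sub_left, inner_sub_right, laplacian_isSymmetric hk f g, real_inner_smul_left,
    real_inner_smul_right]

theorem shiftedLaplacian_mem_meanZero (hk : LipKernel w.clamp K) (μ : ℝ) (f : L2Unit)
    (hf : f ∈ meanZero) : shiftedLaplacian hk μ f ∈ meanZero := by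
  rw [meanZero, Submodule.mem_orthogonal_singleton_iff_inner_right] at hf ⊢
  rw [shiftedLaplacian_apply, inner_sub_right, ← laplacian_isSymmetric hk, laplacian_oneL2 hk,
    inner_zero_left, real_inner_smul_right, hf, mul_zero, sub_zero]

/-- The infimum of the quadratic form of the Laplacian over the mean-zero unit sphere. -/
noncomputable def gap (w : Graphon) : ℝ :=
  sInf ((fun f : L2Unit => inner ℝ (w.laplacian f) f) '' meanZeroSphere)

theorem gap_bddBelow (hk : LipKernel w.clamp K) :
    BddBelow ((fun f : L2Unit => inner ℝ (w.laplacian f) f) '' meanZeroSphere) := by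
  refine ⟨-‖shiftedLaplacian hk 0‖, ?_⟩
  rintro _ ⟨f, hf, rfl⟩
  have h := (mem_meanZeroSphere.1 hf).2
  have h1 := (shiftedLaplacian hk 0).le_opNorm f
  rw [shiftedLaplacian_apply, zero_smul, sub_zero, h, mul_one] at h1
  have h2 := (abs_le.1 (abs_real_inner_le_norm (w.laplacian f) f)).1
  rw [h, mul_one] at h2
  dsimp only
  linarith

theorem gap_mul_norm_sq_le (hk : LipKernel w.clamp K) {f : L2Unit} (hf : f ∈ meanZero) :
    w.gap * ‖f‖ ^ 2 ≤ inner ℝ (w.laplacian f) f := by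
  rcases eq_or_ne f 0 with rfl | hne
  · simp
  have hn : ‖f‖ ≠ 0 := norm_ne_zero_iff.2 hne
  have h : w.gap ≤ inner ℝ (w.laplacian (‖f‖⁻¹ • f)) (‖f‖⁻¹ • f) :=
    csInf_le (gap_bddBelow hk) (mem_image_of_mem _
      (mem_meanZeroSphere.2 ⟨meanZero.smul_mem _ hf, norm_smul_inv_norm hne⟩))
  rw [map_smul, real_inner_smul_left, real_inner_smul_right] at h
  calc w.gap * ‖f‖ ^ 2
      ≤ (‖f‖⁻¹ * (‖f‖⁻¹ * inner ℝ (w.laplacian f) f)) * ‖f‖ ^ 2 :=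
        mul_le_mul_of_nonneg_right h (sq_nonneg _)
    _ = inner ℝ (w.laplacian f) f := by field_simp

theorem inner_shiftedLaplacian (hk : LipKernel w.clamp K) (μ : ℝ) (f : L2Unit) :
    inner ℝ (shiftedLaplacian hk μ f) f = inner ℝ (w.laplacian f) f - μ * ‖f‖ ^ 2 := by
  rw [shiftedLaplacian_apply, inner_sub_left, real_inner_smul_left, real_inner_self_eq_norm_sq]

/-- Makes minimizing sequences approximate eigenvectors, and exact minimizers eigenvectors. -/
theorem norm_sq_shiftedLaplacian_le (hk : LipKernel w.clamp K) {f : L2Unit} (hf : f ∈ meanZero) :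
    ‖shiftedLaplacian hk w.gap f‖ ^ 2 ≤
      (‖shiftedLaplacian hk w.gap‖ + 1) * (inner ℝ (w.laplacian f) f - w.gap * ‖f‖ ^ 2) := by
  rw [← inner_shiftedLaplacian hk]
  refine norm_sq_apply_le_of_nonneg_on (shiftedLaplacian_isSymmetric hk _)
    (shiftedLaplacian_mem_meanZero hk _) (fun g hg => ?_) hf
  rw [inner_shiftedLaplacian]
  exact sub_nonneg.2 (gap_mul_norm_sq_le hk hg)

/-- Minimizers of the quadratic form are eigenfunctions. -/
theorem laplacian_eq_of_le (hk : LipKernel w.clamp K) {f : L2Unit} (hf : f ∈ meanZero)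
    (h : inner ℝ (w.laplacian f) f ≤ w.gap * ‖f‖ ^ 2) : w.laplacian f = w.gap • f := by
  have h1 := norm_sq_shiftedLaplacian_le hk hf
  have h2 : (‖shiftedLaplacian hk w.gap‖ + 1) * (inner ℝ (w.laplacian f) f - w.gap * ‖f‖ ^ 2) ≤ 0 :=
    mul_nonpos_of_nonneg_of_nonpos (by positivity) (sub_nonpos.2 h)
  have h3 : ‖shiftedLaplacian hk w.gap f‖ = 0 :=
    pow_eq_zero_iff two_ne_zero |>.1 (le_antisymm (h1.trans h2) (sq_nonneg _))
  exact sub_eq_zero.1 (norm_eq_zero.1 h3)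

/-- Coercivity of `𝕃 - μ` up to the integral operator, for `μ` below the degrees. -/
theorem mul_norm_le (hk : LipKernel w.clamp K) {μ δ S : ℝ} (hδ : 0 ≤ δ)
    (hd : ∀ x, δ ≤ kernelDeg w.clamp x - μ) (f : L2Unit) (hS0 : 0 ≤ S)
    (hS : ∀ x ∈ Icc (0 : ℝ) 1, |kernelInt w.clamp f x| ≤ S) :
    δ * ‖f‖ ≤ ‖shiftedLaplacian hk μ f‖ + S := by
  have hm : MemLp (kernelInt w.clamp f) 2 unitMeasure :=
    MemLp.of_bound (hk.continuous_kernelInt (integrable_coe f)).aestronglyMeasurable _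
      (Filter.Eventually.of_forall fun x => hk.abs_kernelInt_le (integrable_coe f) x)
  -- Adding the integral term back to (𝕃 - μ)f leaves (d - μ)f, which is at least δ|f| pointwise in
  -- absolute value.
  have h1 : ‖δ • f‖ ≤ ‖shiftedLaplacian hk μ f + hm.toLp _‖ := by
    refine Lp.norm_le_norm_of_ae_le ?_
    rw [shiftedLaplacian_apply]
    filter_upwards [Lp.coeFn_smul δ f, Lp.coeFn_add (w.laplacian f - μ • f) (hm.toLp _),
      Lp.coeFn_sub (w.laplacian f) (μ • f), Lp.coeFn_smul μ f, hm.coeFn_toLp,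
      coeFn_laplacian hk f] with x e1 e2 e3 e4 e5 e6
    rw [e1, e2, Pi.add_apply, e3, Pi.sub_apply, e4, e5, e6, Pi.smul_apply, Pi.smul_apply,
      kernelLap, smul_eq_mul, smul_eq_mul, Real.norm_eq_abs, Real.norm_eq_abs,
      show kernelDeg w.clamp x * f x - kernelInt w.clamp f x - μ * f x + kernelInt w.clamp f x =
        (kernelDeg w.clamp x - μ) * f x by ring, abs_mul, abs_mul, abs_of_nonneg hδ,
      abs_of_nonneg (hδ.trans (hd x))]
    exact mul_le_mul_of_nonneg_right (hd x) (abs_nonneg _)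
  have h2 : ‖hm.toLp _‖ ≤ S := by
    have : ∀ᵐ x ∂unitMeasure, ‖hm.toLp _ x‖ ≤ S := by
      filter_upwards [hm.coeFn_toLp, ae_restrict_mem measurableSet_Icc] with x hx hxI
      rw [hx]
      exact hS x hxI
    simpa [measureUnivNNReal] using Lp.norm_le_of_ae_bound hS0 this
  rw [norm_smul, Real.norm_eq_abs, abs_of_nonneg hδ] at h1
  exact h1.trans ((norm_add_le _ _).trans (by linarith))

theorem integral_abs_le_norm (f : L2Unit) : ∫ x, |f x| ∂unitMeasure ≤ ‖f‖ := by
  have h1 : ∫ x, |f x| ∂unitMeasure = inner ℝ oneL2 |f| := by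
    rw [inner_oneL2]
    exact integral_congr_ae ((Lp.coeFn_abs f).mono fun x hx => hx.symm)
  have h2 : ‖oneL2‖ = 1 := by
    rw [← sq_eq_sq₀ (norm_nonneg _) zero_le_one, norm_sq_eq_integral,
      integral_congr_ae (coeFn_oneL2.mono fun x hx => by rw [hx])]
    simp
  rw [h1]
  refine (real_inner_le_norm _ _).trans ?_
  rw [h2, one_mul, norm_abs_eq_norm]

theorem kernelInt_sub (hk : LipKernel w.clamp K) (f g : L2Unit) (x : ℝ) :
    kernelInt w.clamp (f - g : L2Unit) x = kernelInt w.clamp f x - kernelInt w.clamp g x := by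
  rw [kernelInt_congr (Lp.coeFn_sub f g), kernelInt, kernelInt, kernelInt,
    ← integral_sub (hk.integrable_mul (integrable_coe f) x)
      (hk.integrable_mul (integrable_coe g) x)]
  simp_rw [Pi.sub_apply, mul_sub]

/-- Compactness of the integral operator, as a uniform Cauchy subsequence. -/
theorem exists_subseq_kernelInt_cauchy (hk : LipKernel w.clamp K) (f : ℕ → L2Unit)
    (hf : ∀ n, ‖f n‖ = 1) : ∃ φ : ℕ → ℕ, StrictMono φ ∧ ∀ ε > 0, ∃ N, ∀ m ≥ N, ∀ n ≥ N,
      ∀ x ∈ Icc (0 : ℝ) 1, |kernelInt w.clamp (f (φ m)) x - kernelInt w.clamp (f (φ n)) x| ≤ ε := by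
  have hbd : ∀ n, ∫ x, |f n x| ∂unitMeasure ≤ 1 := fun n => (integral_abs_le_norm _).trans (hf n).le
  let G : ℕ → BoundedContinuousFunction (Icc (0 : ℝ) 1) ℝ := fun n =>
    BoundedContinuousFunction.mkOfCompact ⟨fun x => kernelInt w.clamp (f n) x,
      (hk.continuous_kernelInt (integrable_coe (f n))).comp continuous_subtype_val⟩
  have hG : ∀ n x, G n x = kernelInt w.clamp (f n) x := fun _ _ => rfl
  have hcomp : IsCompact (closure (range G)) := by
    -- The L¹ norms are at most 1, so the images are bounded by 1 and K-Lipschitz.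
    refine BoundedContinuousFunction.arzela_ascoli (Icc (-1) 1) isCompact_Icc _ ?_ ?_
    · rintro _ x ⟨n, rfl⟩
      exact abs_le.1 ((hk.abs_kernelInt_le (integrable_coe _) _).trans (hbd n))
    · refine (LipschitzWith.uniformEquicontinuous _ (Real.toNNReal K) ?_).equicontinuous
      rintro ⟨_, n, rfl⟩
      refine LipschitzWith.of_dist_le_mul fun x y => ?_
      rw [Real.coe_toNNReal _ hk.K_nonneg]
      refine (hk.abs_kernelInt_sub_le (integrable_coe _) _ _).trans ?_
      exact mul_le_mul_of_nonneg_right (mul_le_of_le_one_right hk.K_nonneg (hbd n)) (abs_nonneg _)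
  obtain ⟨g, _, φ, hφ, hlim⟩ := hcomp.tendsto_subseq fun n => subset_closure (mem_range_self n)
  refine ⟨φ, hφ, fun ε hε => ?_⟩
  obtain ⟨N, hN⟩ := Metric.cauchySeq_iff.1 hlim.cauchySeq ε hε
  refine ⟨N, fun m hm n hn x hx => ?_⟩
  have := (BoundedContinuousFunction.dist_coe_le_dist (f := G (φ m)) (g := G (φ n)) ⟨x, hx⟩).trans
    (hN m hm n hn).le
  simpa only [hG, Real.dist_eq] using this

/-- The infimum of the quadratic form over the mean-zero unit sphere is attained. -/
theorem exists_minimizer (hk : LipKernel w.clamp K) (h4 : w.HasSpectralGap) :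
    ∃ f ∈ meanZero, ‖f‖ = 1 ∧ w.laplacian f = w.gap • f := by
  obtain ⟨u, -, hu, hmem⟩ := exists_seq_tendsto_sInf
    (meanZeroSphere_nonempty.image fun f : L2Unit => inner ℝ (w.laplacian f) f) (gap_bddBelow hk)
  choose f hf hfu using hmem
  have hf0 : ∀ n, f n ∈ meanZero := fun n => (mem_meanZeroSphere.1 (hf n)).1
  have hf1 : ∀ n, ‖f n‖ = 1 := fun n => (mem_meanZeroSphere.1 (hf n)).2
  set B := shiftedLaplacian hk w.gap with hB
  have hr : Filter.Tendsto (fun n => B (f n)) Filter.atTop (nhds 0) := by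
    have hsq : Filter.Tendsto (fun n => ‖B (f n)‖ ^ 2) Filter.atTop (nhds 0) := by
      refine squeeze_zero (g := fun n => (‖B‖ + 1) * (u n - w.gap)) (fun n => sq_nonneg _)
        (fun n => ?_) ?_
      · have := norm_sq_shiftedLaplacian_le hk (hf0 n)
        rw [hf1 n, one_pow, mul_one] at this
        rw [← hfu n]
        exact this
      · have := (hu.sub_const w.gap).const_mul (‖B‖ + 1)
        rwa [show sInf _ - w.gap = 0 from sub_self _, mul_zero] at this
    rw [tendsto_zero_iff_norm_tendsto_zero]
    have := (Real.continuous_sqrt.tendsto 0).comp hsq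
    simpa [Function.comp_def, Real.sqrt_sq (norm_nonneg _)] using this
  obtain ⟨φ, hφ, hcauchy⟩ := exists_subseq_kernelInt_cauchy hk f hf1
  set δ := sInf (w.degree '' Icc (0 : ℝ) 1) - w.gap with hδ
  have hδ0 : 0 < δ := sub_pos.2 h4
  have hd : ∀ x, δ ≤ kernelDeg w.clamp x - w.gap := fun x => sub_le_sub_right (sInf_degree_le x) _
  have hrc := (hr.comp hφ.tendsto_atTop).cauchySeq
  -- Coercivity applied to differences: both the residuals and the integral terms are Cauchy, each
  -- contributing δε/2.
  have hc : CauchySeq (f ∘ φ) := by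
    rw [Metric.cauchySeq_iff] at hrc ⊢
    intro ε hε
    obtain ⟨N₁, h₁⟩ := hrc (δ * ε / 2) (by positivity)
    obtain ⟨N₂, h₂⟩ := hcauchy (δ * ε / 2) (by positivity)
    refine ⟨max N₁ N₂, fun m hm n hn => ?_⟩
    have h3 := h₁ m (le_of_max_le_left hm) n (le_of_max_le_left hn)
    have h4 := mul_norm_le hk hδ0.le hd (f (φ m) - f (φ n)) (S := δ * ε / 2) (by positivity)
      fun x hx => by
        rw [kernelInt_sub hk]
        exact h₂ m (le_of_max_le_right hm) n (le_of_max_le_right hn) x hx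
    rw [Function.comp_apply, Function.comp_apply, dist_eq_norm, ← map_sub] at h3
    rw [Function.comp_apply, Function.comp_apply, dist_eq_norm]
    exact lt_of_mul_lt_mul_left (h4.trans_lt (by linarith)) hδ0.le
  obtain ⟨g, hg⟩ := cauchySeq_tendsto_of_complete hc
  refine ⟨g, ?_, ?_, ?_⟩
  · exact (Submodule.isClosed_orthogonal _).mem_of_tendsto hg
      (Filter.Eventually.of_forall fun n => hf0 (φ n))
  · refine tendsto_nhds_unique hg.norm ?_
    simp only [Function.comp_apply, hf1]
    exact tendsto_const_nhds
  · have h1 := (B.continuous.tendsto g).comp hg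
    have h2 := tendsto_nhds_unique h1 (hr.comp hφ.tendsto_atTop)
    exact sub_eq_zero.1 h2

end Graphon

/-! ### Lipschitz representatives of eigenfunctions -/

theorem exists_lipschitzWith_div {f g : ℝ → ℝ} {A B : NNReal} {M δ : ℝ} (hf : LipschitzWith A f)
    (hg : LipschitzWith B g) (hM : ∀ x, |f x| ≤ M) (hδ : 0 < δ) (hgδ : ∀ x, δ ≤ g x) :
    ∃ C, LipschitzWith C fun x => f x / g x := by
  have hM0 : 0 ≤ M := (abs_nonneg _).trans (hM 0)
  have hpos : ∀ x, 0 < g x := fun x => hδ.trans_le (hgδ x)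
  refine ⟨Real.toNNReal (A / δ + M * B / δ ^ 2), LipschitzWith.of_dist_le_mul fun x y => ?_⟩
  rw [Real.coe_toNNReal _ (by positivity), Real.dist_eq]
  have h1 : |f x - f y| ≤ A * dist x y := hf.dist_le_mul x y
  have h2 : |g y - g x| ≤ B * dist x y := by
    rw [dist_comm]
    exact hg.dist_le_mul y x
  have e : f x / g x - f y / g y = (f x - f y) / g x + f y * (g y - g x) / (g x * g y) := by
    have := (hpos x).ne'
    have := (hpos y).ne'
    field_simp
    ring
  rw [e]
  refine (abs_add_le _ _).trans ?_
  rw [abs_div, abs_div, abs_mul, abs_of_pos (hpos x), abs_of_pos (mul_pos (hpos x) (hpos y)),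
    add_mul]
  refine add_le_add ?_ ?_
  · calc |f x - f y| / g x ≤ A * dist x y / δ := div_le_div₀ (by positivity) h1 hδ (hgδ x)
      _ = A / δ * dist x y := by ring
  · calc |f y| * |g y - g x| / (g x * g y) ≤ M * (B * dist x y) / δ ^ 2 := by
          refine div_le_div₀ (by positivity) (mul_le_mul (hM y) h2 (abs_nonneg _) hM0)
            (by positivity) ?_
          rw [sq]
          exact mul_le_mul (hgδ x) (hgδ y) hδ.le (hpos x).le
      _ = M * B / δ ^ 2 * dist x y := by ring

namespace Graphon

variable {w : Graphon} {K : ℝ}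

/-- The continuous representative of an eigenfunction with eigenvalue `μ`. -/
noncomputable def eigenRep (w : Graphon) (μ : ℝ) (f : ℝ → ℝ) (x : ℝ) : ℝ :=
  kernelInt w.clamp f x / (kernelDeg w.clamp x - μ)

theorem exists_lipschitzWith_eigenRep (hk : LipKernel w.clamp K) {μ : ℝ}
    (hμ : μ < sInf (w.degree '' Icc (0 : ℝ) 1)) {f : ℝ → ℝ} (hf : Integrable f unitMeasure) :
    ∃ C, LipschitzWith C (eigenRep w μ f) := by
  refine exists_lipschitzWith_div (B := Real.toNNReal K) (hk.lipschitzWith_kernelInt hf) ?_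
    (hk.abs_kernelInt_le hf) (sub_pos.2 hμ) fun x => sub_le_sub_right (sInf_degree_le x) _
  refine LipschitzWith.of_dist_le_mul fun x y => ?_
  rw [dist_sub_right]
  exact hk.lipschitzWith_kernelDeg.dist_le_mul x y

theorem ae_eq_eigenRep (hk : LipKernel w.clamp K) {μ : ℝ}
    (hμ : μ < sInf (w.degree '' Icc (0 : ℝ) 1)) {f : L2Unit} (hf : w.laplacian f = μ • f) :
    f =ᵐ[unitMeasure] eigenRep w μ f := by
  filter_upwards [coeFn_laplacian hk f, Lp.coeFn_smul μ f] with x h1 h2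
  have hpos : 0 < kernelDeg w.clamp x - μ := sub_pos.2 (hμ.trans_le (sInf_degree_le x))
  rw [hf, h2, kernelLap, Pi.smul_apply, smul_eq_mul] at h1
  rw [eigenRep, eq_div_iff hpos.ne']
  linarith

theorem kernelLap_eigenRep (hk : LipKernel w.clamp K) {μ : ℝ}
    (hμ : μ < sInf (w.degree '' Icc (0 : ℝ) 1)) {f : L2Unit} (hf : w.laplacian f = μ • f) (x : ℝ) :
    kernelLap w.clamp (eigenRep w μ f) x = μ * eigenRep w μ f x := by
  have hpos : 0 < kernelDeg w.clamp x - μ := sub_pos.2 (hμ.trans_le (sInf_degree_le x))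
  rw [kernelLap, ← kernelInt_congr (ae_eq_eigenRep hk hμ hf), eigenRep]
  field_simp
  ring

theorem eq_zero_of_ae_const {f : L2Unit} (hf : f ∈ meanZero) {c : ℝ}
    (h : ∀ᵐ x ∂unitMeasure, f x = c) : f = 0 := by
  rw [mem_meanZero, integral_congr_ae h] at hf
  have hc : c = 0 := by simpa using hf
  refine Lp.ext ?_
  filter_upwards [h, Lp.coeFn_zero ℝ 2 unitMeasure] with x h1 h2
  rw [h1, h2, hc]
  rfl

/-- Eigenvectors for distinct eigenvalues are orthogonal, and constants have eigenvalue 0. -/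
theorem mem_meanZero_of_laplacian_eq (hk : LipKernel w.clamp K) {a : ℝ} (ha : a ≠ 0)
    {f : L2Unit} (hf : w.laplacian f = a • f) : f ∈ meanZero := by
  have h := laplacian_isSymmetric hk oneL2 f
  rw [laplacian_oneL2 hk, inner_zero_left, hf, real_inner_smul_right] at h
  rw [meanZero, Submodule.mem_orthogonal_singleton_iff_inner_right]
  exact (mul_eq_zero.1 h.symm).resolve_left ha

/-- Otherwise a minimizer would lie in the null space, hence be constant and of mean zero,
contradicting its unit norm. -/
theorem gap_ne_zero (hk : LipKernel w.clamp K) (hD : StrictRobinson w.clamp)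
    (h4 : w.HasSpectralGap) : w.gap ≠ 0 := by
  intro h0
  obtain ⟨f, hf, hf1, hL⟩ := exists_minimizer hk h4
  obtain ⟨C, hC⟩ := exists_lipschitzWith_eigenRep hk (μ := w.gap) h4 (integrable_coe f)
  obtain ⟨c, hc⟩ := hk.ae_const_of_kernelLap_eq_zero hD hC.continuous fun x _ => by
    exact (kernelLap_eigenRep hk (μ := w.gap) h4 hL x).trans (by rw [h0, zero_mul])
  have hz := eq_zero_of_ae_const hf (c := c) (by
    filter_upwards [hc, ae_eq_eigenRep hk h4 hL] with x h1 h2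
    rw [h2]
    exact h1)
  rw [hz, norm_zero] at hf1
  exact zero_ne_one hf1

/-- Minimality: any eigenvector with non-zero eigenvalue has mean zero, so its Rayleigh quotient is
at least `gap`. -/
theorem isFiedlerValue_gap (hk : LipKernel w.clamp K) (hD : StrictRobinson w.clamp)
    (h4 : w.HasSpectralGap) : w.IsFiedlerValue w.gap := by
  obtain ⟨f, hf, hf1, hL⟩ := exists_minimizer hk h4
  refine ⟨⟨gap_ne_zero hk hD h4, ?_⟩, ?_⟩
  · refine Module.End.hasEigenvalue_of_hasEigenvector (x := f)
      ⟨Module.End.mem_eigenspace_iff.2 hL, ?_⟩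
    rw [← norm_ne_zero_iff, hf1]
    exact one_ne_zero
  · rintro a ⟨ha, hev⟩
    obtain ⟨g, hg⟩ := hev.exists_hasEigenvector
    have hLg := hg.apply_eq_smul
    have h := gap_mul_norm_sq_le hk (mem_meanZero_of_laplacian_eq hk ha hLg)
    rw [hLg, real_inner_smul_left, real_inner_self_eq_norm_sq] at h
    exact le_of_mul_le_mul_right h (pow_pos (norm_pos_iff.2 hg.2) 2)

/-- Supplies `hvar`: the integral condition says that the class of F attains the infimum up to
scaling, and continuity upgrades the resulting a.e. equation to every point. -/
theorem kernelLap_eq_of_defect_nonneg (hk : LipKernel w.clamp K) {F : ℝ → ℝ} (hF : Continuous F)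
    (h0 : ∫ x, F x ∂unitMeasure = 0)
    (h : 0 ≤ ∫ x, (w.gap * F x - kernelLap w.clamp F x) * F x ∂unitMeasure) :
    ∀ x ∈ Icc (0 : ℝ) 1, kernelLap w.clamp F x = w.gap * F x := by
  have hm : MemLp F 2 unitMeasure := (memLp_two_iff_integrable_sq hF.aestronglyMeasurable).2
    (integrable_unitMeasure_of_continuous (hF.pow 2))
  have hcoe := hm.coeFn_toLp
  have hlap : w.laplacian (hm.toLp F) =ᵐ[unitMeasure] kernelLap w.clamp F := by
    filter_upwards [coeFn_laplacian hk (hm.toLp F), hcoe] with x h1 h2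
    rw [h1, kernelLap, kernelInt_congr hcoe, h2]
    rfl
  have hmem : hm.toLp F ∈ meanZero := by
    rw [mem_meanZero, integral_congr_ae hcoe, h0]
  have hle : inner ℝ (w.laplacian (hm.toLp F)) (hm.toLp F) ≤ w.gap * ‖hm.toLp F‖ ^ 2 := by
    have hcL := hk.continuous_kernelLap hF
    have c1 : Continuous fun x => w.gap * F x ^ 2 := by fun_prop
    have c2 : Continuous fun x => kernelLap w.clamp F x * F x := by fun_prop
    rw [inner_eq_integral, norm_sq_eq_integral, ← sub_nonneg]
    convert! h using 1
    have e1 : ∫ x, hm.toLp F x ^ 2 ∂unitMeasure = ∫ x, F x ^ 2 ∂unitMeasure :=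
      integral_congr_ae (hcoe.mono fun x hx => by simp only [hx])
    have e2 : ∫ x, w.laplacian (hm.toLp F) x * hm.toLp F x ∂unitMeasure =
        ∫ x, kernelLap w.clamp F x * F x ∂unitMeasure := by
      refine integral_congr_ae ?_
      filter_upwards [hlap, hcoe] with x h1 h2
      rw [h1, h2]
    rw [e1, e2, ← integral_const_mul, ← integral_sub (integrable_unitMeasure_of_continuous c1)
      (integrable_unitMeasure_of_continuous c2)]
    congr 1
    funext x
    ring
  have hL := laplacian_eq_of_le hk hmem hle
  refine eqOn_Icc_of_ae_unitMeasure (hk.continuous_kernelLap hF) (continuous_const.mul hF) ?_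
  filter_upwards [hlap, hcoe, Lp.coeFn_smul w.gap (hm.toLp F)] with x h1 h2 h3
  rw [← h1, hL, h3, Pi.smul_apply, h2, smul_eq_mul]

/-! ### Dimension of the eigenspace -/

/-- An eigenfunction of the Fiedler value whose continuous representative takes equal values at the
end points vanishes. -/
theorem eq_zero_of_eigenRep_endpoints (hk : LipKernel w.clamp K) (hD : StrictRobinson w.clamp)
    (h4 : w.HasSpectralGap) {f : L2Unit} (hf : w.laplacian f = w.gap • f)
    (h01 : eigenRep w w.gap f 0 = eigenRep w w.gap f 1) : f = 0 := by
  obtain ⟨C, hC⟩ := exists_lipschitzWith_eigenRep hk (μ := w.gap) h4 (integrable_coe f)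
  have h := hk.eq_of_kernelLap_eq_of_eq_endpoints hD hC
    (fun x _ => kernelLap_eigenRep hk h4 hf x)
    (fun x _ => (h4.le.trans (sInf_degree_le x) : w.gap ≤ _))
    (fun F hF h0 hdef => kernelLap_eq_of_defect_nonneg hk hF h0 hdef) h01
  refine eq_zero_of_ae_const (mem_meanZero_of_laplacian_eq hk (gap_ne_zero hk hD h4) hf)
    (c := eigenRep w w.gap f 0) ?_
  filter_upwards [ae_eq_eigenRep hk h4 hf, ae_restrict_mem measurableSet_Icc] with x h1 h2
  rw [h1]
  exact h x h2

/-- Evaluation of the continuous representative at a point, as a linear functional. -/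
noncomputable def eigenRepLinear (hk : LipKernel w.clamp K) (μ x : ℝ) : L2Unit →ₗ[ℝ] ℝ where
  toFun f := eigenRep w μ f x
  map_add' f g := by
    rw [eigenRep, eigenRep, eigenRep, ← add_div, kernelInt_congr (Lp.coeFn_add f g), kernelInt,
      kernelInt, kernelInt, ← integral_add (hk.integrable_mul (integrable_coe f) x)
      (hk.integrable_mul (integrable_coe g) x)]
    simp_rw [Pi.add_apply, mul_add]
  map_smul' c f := by
    rw [eigenRep, eigenRep, kernelInt_congr (Lp.coeFn_smul c f), kernelInt, kernelInt,
      RingHom.id_apply, smul_eq_mul, ← mul_div_assoc, ← integral_const_mul]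
    simp_rw [Pi.smul_apply, smul_eq_mul, mul_left_comm]

theorem finrank_eigenspace_gap (hk : LipKernel w.clamp K) (hD : StrictRobinson w.clamp)
    (h4 : w.HasSpectralGap) :
    Module.finrank ℝ (Module.End.eigenspace w.laplacian w.gap) = 1 := by
  let φ : Module.End.eigenspace w.laplacian w.gap →ₗ[ℝ] ℝ :=
    (eigenRepLinear hk w.gap 0 - eigenRepLinear hk w.gap 1).comp (Submodule.subtype _)
  have hφ : Function.Injective φ := by
    rw [← LinearMap.ker_eq_bot, LinearMap.ker_eq_bot']
    intro f hf
    exact Subtype.ext (eq_zero_of_eigenRep_endpoints hk hD h4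
      (Module.End.mem_eigenspace_iff.1 f.2) (sub_eq_zero.1 hf))
  refine le_antisymm ?_ ?_
  · simpa using LinearMap.finrank_le_finrank_of_injective hφ
  -- `finrank` defaults to 0 in infinite dimension, so the lower bound needs finiteness, which the
  -- injection into ℝ provides.
  · have := Module.Finite.of_injective φ hφ
    obtain ⟨f, -, hf1, hL⟩ := exists_minimizer hk h4
    refine Module.finrank_pos_iff_exists_ne_zero.2
      ⟨⟨f, Module.End.mem_eigenspace_iff.2 hL⟩, fun h => ?_⟩
    rw [show f = 0 from congrArg Subtype.val h, norm_zero] at hf1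
    exact zero_ne_one hf1

end Graphon

theorem mainTheorem5 (w : Graphon) (hR : w.IsRobinsonian) (h1 : w.IsLipschitz)
    (h2 : w.HasNonzeroPartialDeriv) (h3 : w.HasRegularDegree) (h4 : w.HasSpectralGap) :
    ∃ l : ℝ, w.IsFiedlerValue l ∧
      Module.finrank ℝ (Module.End.eigenspace w.laplacian l) = 1 := by
  obtain ⟨K, hk⟩ := h1.exists_lipKernel
  have hD := Graphon.strictRobinson_clamp hR h2
  exact ⟨w.gap, Graphon.isFiedlerValue_gap hk hD h4, Graphon.finrank_eigenspace_gap hk hD h4⟩
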